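/- **Setting.** Let $W=\{0,\dots,2^{256}-1\}$. The *state variables* are: stack variables $\mathsf{s}_k$ ($k\in\mathbb N$); for every location $\ell\in W$ a static and a dynamic memory variable $\mathsf m^s_\ell,\mathsf m^d_\ell$ and a static and a dynamic storage variable $\mathsf t^s_\ell,\mathsf t^d_\ell$; local environment variables $g$ (gas), $i$ (active words in memory), actor, input, sender, value, code; global environment variables parent, beneficiary, difficulty, number, gaslimit, timestamp, origin, gas price, external. Every state variable $v$ also has a temporal copy $\bar v$; *variables* are state variables and temporal copies. $M$, $M^d$, $S$, $S^d$, $G$ denote the sets of all memory, all dynamic memory, all storage, all dynamic storage and all global environment variables; $\bar T$ is the set of all temporal copies. A *contract* $C$ is a partial map that assigns to a program counter $pc\in W$ an EVM instruction over stack variables, the next program counter $pc'$, and a partial map $\mathit{pre}$ giving the statically known values of arguments of the instruction. (DELEGATECALL and CALLCODE are excluded.) The *CFG* of $C$ has nodes $(pc,j)$, $j\in\mathbb N$, and $\mathit{halt}$, $\mathit{exception}$, $\mathit{exit}$, with edges $\mathit{halt}\to\mathit{exit}$, $\mathit{exception}\to\mathit{exit}$. Each instruction at $pc$ contributes a sequence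 of subnodes $(pc,0)\to(pc,1)\to\cdots$, the last of which leads to $(pc',0)$ unless stated otherwise; below, "$D\leftarrow U$" is a subnode with $\mathrm{Def}=D$, $\mathrm{Use}=U$. Nodes without a rule have empty Def and Use. $[o,o+s)$ is the set of $\ell\in W$ with $o\le\ell<o+s$. * Instructions computing a stack variable $y$: $y\leftarrow U$; $g\leftarrow g$. Here $U$ is the set of operands for unary, binary and ternary operations, EXP and assignment (EXP reads its second operand also in the gas step); actor, sender, value, code, input, origin, gas price, beneficiary, timestamp, number, gaslimit, difficulty, for ADDRESS, CALLER, CALLVALUE, CODESIZE, CALLDATASIZE, ORIGIN, GASPRICE, COINBASE, TIMESTAMP, NUMBER, GASLIMIT, DIFFICULTY respectively; input and the operand for CALLDATALOAD; parent and the operand for BLOCKHASH; external and the operand for BALANCE and EXTCODESIZE; $g$, $\emptyset$, $i$ for GAS, PC, MSIZE; for SLOAD$(y,x)$: $\mathsf t^s_\ell,\mathsf t^d_\ell$ if the location is known to be $\ell$, and $S\cup\{x\}$ otherwise. * SHA3$(y,x_1,x_2)$: $y\leftarrow x_1,x_2,M$; $g\leftarrow g,i,x_1,x_2$; $i\leftarrow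 i,x_1,x_2$. MLOAD$(y,x)$: $y\leftarrow \mathsf m^s_\ell,\mathsf m^d_\ell$ if the location is known to be $\ell$, $y\leftarrow M\cup\{x\}$ otherwise; then $g\leftarrow g,i,x$; $i\leftarrow i,x$. * MSTORE$(x_1,x_2)$: if the location is known to be $\ell$: $\mathsf m^s_\ell\leftarrow x_2$; $\mathsf m^d_\ell\leftarrow\emptyset$; otherwise, from subnode $0$ directly to subnode $2$: $M^d\leftarrow M^d,x_1,x_2$; then $g\leftarrow g,i,x_1$; $i\leftarrow i,x_1$. SSTORE$(x_1,x_2)$: the same with storage, and the only further subnode $g\leftarrow g,x_1,x_2,S$. * CALLDATACOPY, CODECOPY$(x_1,x_2,x_3)$: $M^d\leftarrow$ input (resp. code) and all operands; $g\leftarrow g,i,x_1,x_2,x_3$; $i\leftarrow i,x_1,x_3$. EXTCODECOPY$(x_1,\dots,x_4)$: $M^d\leftarrow$ external and all operands; $g\leftarrow g,i,x_2,x_3,x_4$; $i\leftarrow i,x_2,x_4$. * JUMP with known destination $d$: $g\leftarrow g$, leading to $(d,0)$. JUMPI$(x_1,x_2)$ with known destination $d$: $g\leftarrow g$; $\emptyset\leftarrow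 x_2$, leading both to $(pc',0)$ and to $(d,0)$. (No edges if the destination is unknown.) * LOG with memory operands $x_1,x_2$: $g\leftarrow g,i,x_1,x_2$; $i\leftarrow i,x_1,x_2$. RETURN$(x_1,x_2)$: the same, leading to $\mathit{halt}$. STOP: $\emptyset\leftarrow\emptyset$, leading to $\mathit{halt}$. INVALID: $\emptyset\leftarrow\emptyset$, leading to $\mathit{exception}$. SELFDESTRUCT$(x)$: external $\leftarrow$ external, $x$, actor; $g\leftarrow$ external, $x,g$, leading to $\mathit{halt}$. * CREATE, CREATE2 with result $y$: let $A$ consist of the value (and salt) operands, $g$, actor, $G$, $S$ and the input fragment, that is, the static and dynamic memory variables of the fragment if both its bounds are known, and otherwise $M$ with the unknown bounds. Then $\bar y,\overline{\text{external}}\leftarrow A$; $\bar g\leftarrow A,i$; $\bar i\leftarrow i$ and the unknown bounds; $y,\text{external}\leftarrow\bar y,\overline{\text{external}}$; $g\leftarrow\bar g$; $i\leftarrow\bar i$; $\bar T\leftarrow\emptyset$. * CALL, STATICCALL with result $y$, input fragment $[io,io+is)$ and output fragment $[oo,oo+os)$: let $A$ be the gas, address and (for CALL) value operands, $g$, actor,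 $G$, $S$, the input fragment as before, and those of the stack variables of $oo,os$ whose values are unknown. Then $\bar y,\overline{\text{external}}\leftarrow A$ (STATICCALL: $\bar y\leftarrow A$); $\bar g\leftarrow A,i$; $\bar i\leftarrow i$ and the unknown ones of $io,is,oo,os$; memory step; $y,\text{external}\leftarrow\bar y,\overline{\text{external}}$; $g\leftarrow\bar g$; $i\leftarrow\bar i$; copy step; $\bar T\leftarrow\emptyset$. Memory step: if both fragments are known, a subnode $\overline{\mathsf m}^s_\ell\leftarrow A,\mathsf m^s_\ell,\mathsf m^d_\ell$ for each location $\ell$ of the output fragment in turn (one subnode for each of its $os$ positions; a position beyond the last location contributes an empty Def and no location to Use), then $\{\overline{\mathsf m}^d_\ell\}_{\ell\in[oo,oo+os)}\leftarrow\emptyset$; if only the input fragment is known, a subnode $\overline{\mathsf m}^d_\ell\leftarrow A,\mathsf m^s_\ell,\mathsf m^d_\ell$ for each $\ell\in W$ in turn; if only the output fragment is known, $\{\overline{\mathsf m}^s_\ell\}_{\ell\in[oo,oo+os)}\leftarrow A$ and then $\{\overline{\mathsf m}^d_\ell\}_{\ell\in[oo,oo+os)}\leftarrow\emptyset$; if neither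 is, $\overline{M^d}\leftarrow A$. The copy step consists of the corresponding subnodes, each defining the variables whose temporal copies were defined and using these copies. **Dependence.** Node $n'$ is *data dependent* on $n$ if some $v\in\mathrm{Def}(n)\cap\mathrm{Use}(n')$ admits a nonempty CFG path from $n$ to $n'$ with no node strictly in between defining $v$. Node $n'$ is *control dependent* on $n$, $n\to_{cd}n'$, if $n$ can reach $\mathit{exit}$ without passing through $n'$, and there is a CFG path from $n$ to $n'$ such that no other node on it can reach $\mathit{exit}$ without passing through $n'$. The program dependence graph has the CFG nodes and all data and control dependence edges; the backward slice $BS(n)$ is the set of nodes that reach $n$ in it (including $n$). **Rules.** $\mathcal R_C$ is the following set of ground Horn clauses, for all nodes and variables subject to the side conditions; $\mathrm{lfp}(\mathcal R_C)$ is the least fixpoint of its immediate consequence operator. 1. $\top\Rightarrow\mathsf{Local}_n(y,z)$ for $y\in\mathrm{Def}(n),z\in\mathrm{Use}(n)$; $\ \top\Rightarrow\mathsf{Write}_n(y)$ for $y\in\mathrm{Def}(n)$; $\ \top\Rightarrow\mathsf{Controls}_n(b,z)$ for $b\to_{cd}n$, $z\in\mathrm{Use}(b)$. 2. $\mathsf{Controls}_n(b,z)\Rightarrow\mathsf{MayControls}_n(b,z)$;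 $\ \mathsf{Controls}_n(b,z)\wedge\mathsf{MayControls}_b(b',z')\Rightarrow\mathsf{MayControls}_n(b',z')$. 3. $\mathsf{Write}_n(y)\wedge\mathsf{Write}_n(x)\Rightarrow\mathsf{MayDependOn}_n(y,x)$; $\ \mathsf{Local}_n(y,x)\Rightarrow\mathsf{MayDependOn}_n(y,x)$. 4. $\mathsf{Local}_n(y,z)\wedge\mathsf{VarMayDepOn}(z,x)\Rightarrow\mathsf{MayDependOn}_n(y,x)$ if $z$ is a stack variable; $\ \mathsf{Local}_n(y,z)\wedge\mathsf{MayDependOn}_m(z,x)\Rightarrow\mathsf{MayDependOn}_n(y,x)$ if $z$ is not a stack variable and $m\to n$ is a CFG edge. 5. $\mathsf{MayDependOn}_m(y,x)\Rightarrow\mathsf{MayDependOn}_n(y,x)$ if $m\to n$ is a CFG edge and $y\notin\mathrm{Def}(n)$. 6. $\mathsf{Write}_n(y)\wedge\mathsf{MayControls}_n(b,z)\wedge\mathsf{VarMayDepOn}(z,x)\Rightarrow\mathsf{MayDependOn}_n(y,x)$. 7. $\mathsf{MayDependOn}_n(y,x)\Rightarrow\mathsf{VarMayDepOn}(y,x)$.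 8. $\mathsf{MayControls}_n(b,x)\Rightarrow\mathsf{InstMayDepOn}(n,x)$; $\ \mathsf{MayControls}_n(b,z)\wedge\mathsf{VarMayDepOn}(z,x)\Rightarrow\mathsf{InstMayDepOn}(n,x)$. **Lemma (Fixpoint Characterization of Backward Slices).** Let $C$ be a contract and $x,y$ variables. 1. If there are nodes $n_x,n_y$ with $x\in\mathrm{Def}(n_x)$, $y\in\mathrm{Def}(n_y)$ and $n_x\in BS(n_y)$, then $\mathsf{VarMayDepOn}(y,x)\in\mathrm{lfp}(\mathcal R_C)$. 2. For every node $n$: if there are nodes $n_{if},n_x$ with $n_{if}\to_{cd}n$, $x\in\mathrm{Def}(n_x)$ and $n_x\in BS(n_{if})$, then $\mathsf{InstMayDepOn}(n,x)\in\mathrm{lfp}(\mathcal R_C)$. -/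

import Mathlib

namespace EVM

/-! ### Variables of the control flow graph -/

/-- 256-bit words: machine words, memory and storage locations, program counters. -/
abbrev Word : Type := Fin (2 ^ 256)

/-- Local environmental variables (`gas` is the remaining gas, `msize` the number of active
words in memory, `value`/`input` the value and input data of the call, `code` the own code). -/
inductive LocEnv
  | gas | msize | actor | input | sender | value | code

/-- Global environmental variables; `external` is the state of all external accounts. -/
inductive GlobEnv
  | parent | beneficiary | difficulty | number | gaslimit | timestamp | origin | prize | external

/-- The variables of a CFG state. A memory (storage) location occurs in two versions: the static
one, written when the location is known statically, and the dynamic one. -/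
inductive StateVar
  | stack (x : ℕ)
  | memS (l : Word)
  | memD (l : Word)
  | storS (l : Word)
  | storD (l : Word)
  | loc (e : LocEnv)
  | glob (e : GlobEnv)

/-- All variables: those of the state, and one temporal copy of each of them, which is used for
splitting the effects of calls over several nodes. -/
inductive Var
  | perm (v : StateVar)
  | temp (v : StateVar)

/-- The stack variable `x`. -/
abbrev stk (x : ℕ) : Var := .perm (.stack x)
/-- The gas variable. -/
abbrev gasV : Var := .perm (.loc .gas)
/-- The variable for the number of active words in memory. -/
abbrev msizeV : Var := .perm (.loc .msize)
/-- The state of the external accounts. -/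
abbrev externalV : Var := .perm (.glob .external)

/-- Stack variables. Temporal copies are not among them. -/
def Var.IsStack : Var → Prop
  | .perm (.stack _) => True
  | _ => False

/-- The locations `[o, o + s - 1]`. -/
def seg (o s : Word) : Set Word := {l | o.val ≤ l.val ∧ l.val < o.val + s.val}

/-- All static and dynamic memory variables. -/
def memAll : Set Var := {v | ∃ l, v = .perm (.memS l) ∨ v = .perm (.memD l)}
/-- All dynamic memory variables. -/
def memDyn : Set Var := {v | ∃ l, v = .perm (.memD l)}
/-- All static and dynamic storage variables. -/
def storAll : Set Var := {v | ∃ l, v = .perm (.storS l) ∨ v = .perm (.storD l)}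
/-- All dynamic storage variables. -/
def storDyn : Set Var := {v | ∃ l, v = .perm (.storD l)}
/-- All global environmental variables. -/
def globAll : Set Var := {v | ∃ e, v = .perm (.glob e)}
/-- All temporal variables. -/
def tempAll : Set Var := {v | ∃ w, v = .temp w}
/-- The static memory variables of the locations in `S`. -/
def memSOn (S : Set Word) : Set Var := {v | ∃ l ∈ S, v = .perm (.memS l)}
/-- The dynamic memory variables of the locations in `S`. -/
def memDOn (S : Set Word) : Set Var := {v | ∃ l ∈ S, v = .perm (.memD l)}
/-- The temporal copies of `memSOn S`. -/
def tmemSOn (S : Set Word) : Set Var := {v | ∃ l ∈ S, v = .temp (.memS l)}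
/-- The temporal copies of `memDOn S`. -/
def tmemDOn (S : Set Word) : Set Var := {v | ∃ l ∈ S, v = .temp (.memD l)}

/-! ### Contracts -/

/-- Binary stack operations. -/
inductive BinOp
  | ADD | SUB | LT | GT | EQ | AND | OR | XOR | SLT | SGT | MUL | DIV | SDIV | MOD | SMOD
  | SIGNEXTEND | BYTE

/-- Unary stack operations. -/
inductive UnOp
  | ISZERO | NOT

/-- Ternary stack operations. -/
inductive TernOp
  | ADDMOD | MULMOD

/-- Instructions over stack variables; the result variable (if any) comes first. -/
inductive Instr
  | bin (op : BinOp) (y x₁ x₂ : ℕ)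
  | EXP (y x₁ x₂ : ℕ)
  | SHA3 (y x₁ x₂ : ℕ)
  | un (op : UnOp) (y x : ℕ)
  | tern (op : TernOp) (y x₁ x₂ x₃ : ℕ)
  | ASSIGN (y x : ℕ)
  | ADDRESS (y : ℕ)
  | CALLER (y : ℕ)
  | CALLVALUE (y : ℕ)
  | CODESIZE (y : ℕ)
  | CALLDATASIZE (y : ℕ)
  | CALLDATALOAD (y x : ℕ)
  | CALLDATACOPY (x₁ x₂ x₃ : ℕ)
  | CODECOPY (x₁ x₂ x₃ : ℕ)
  | ORIGIN (y : ℕ)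
  | GASPRICE (y : ℕ)
  | COINBASE (y : ℕ)
  | TIMESTAMP (y : ℕ)
  | NUMBER (y : ℕ)
  | GASLIMIT (y : ℕ)
  | DIFFICULTY (y : ℕ)
  | BLOCKHASH (y x : ℕ)
  | BALANCE (y x : ℕ)
  | EXTCODESIZE (y x : ℕ)
  | EXTCODECOPY (x₁ x₂ x₃ x₄ : ℕ)
  | JUMP (x : ℕ)
  | JUMPI (x₁ x₂ : ℕ)
  | MLOAD (y x : ℕ)
  | MSTORE (x₁ x₂ : ℕ)
  | SLOAD (y x : ℕ)
  | SSTORE (x₁ x₂ : ℕ)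
  | GAS (y : ℕ)
  | PC (y : ℕ)
  | MSIZE (y : ℕ)
  | LOG (x₁ x₂ : ℕ) (topics : List ℕ)
  | RETURN (x₁ x₂ : ℕ)
  | STOP
  | INVALID
  | SELFDESTRUCT (x : ℕ)
  | CALL (y g rcv va inOff inSize outOff outSize : ℕ)
  | STATICCALL (y g rcv inOff inSize outOff outSize : ℕ)
  | CREATE (y va inOff inSize : ℕ)
  | CREATE2 (y va salt inOff inSize : ℕ)

/-- The precomputed argument values of an instruction: `pre i` is the value of the `i`-th
variable in the argument list of the instruction (counted from `0`, and including the result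
variable) if it is statically known. -/
abbrev Pre : Type := ℕ → Option Word

/-- A contract maps program counters to an instruction, the next program counter and the
precomputed argument values. -/
abbrev Contract : Type := Word → Option (Instr × Word × Pre)

/-! ### The control flow graph with its Def and Use sets -/

/-- The target of a CFG edge that leaves a subnode of a program counter: another subnode of the
same program counter, the first node of the next instruction, the first node of a jump
destination, or regular or exceptional halting. -/
inductive Target
  | sub (j : ℕ)
  | next
  | jump (d : Word)
  | halt
  | exception

/-- A CFG edge for one instruction: the index of the source subnode, the Def and the Use set of
this subnode, and the target. -/
structure CfgEdge where
  src : ℕ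
  defs : Set Var
  uses : Set Var
  tgt : Target

/-- An instruction that writes `y` reading `U`, and then charges gas reading `G`. -/
def assignEdges (y : ℕ) (U G : Set Var) : Set CfgEdge :=
  {⟨0, {stk y}, U, .sub 1⟩, ⟨1, {gasV}, {gasV} ∪ G, .next⟩}

/-- An instruction that writes all dynamic memory reading `U`, charges gas for memory use reading
`G`, and then extends the active memory reading `M`. -/
def copyEdges (U G M : Set Var) : Set CfgEdge :=
  {⟨0, memDyn, U, .sub 1⟩, ⟨1, {gasV}, {gasV, msizeV} ∪ G, .sub 2⟩,
    ⟨2, {msizeV}, {msizeV} ∪ M, .next⟩}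

/-- The variable `x`, if its value is not known statically. -/
def unknown (p : Option Word) (x : ℕ) : Set Var := {v | p = none ∧ v = stk x}

/-- The variables read with the input memory fragment of a call or creation: the static and
dynamic variables of the fragment if it is known, otherwise the whole memory and the unknown
bounds. -/
def inputFragment (pio pis : Option Word) (io is : ℕ) : Set Var :=
  match pio, pis with
  | some o, some s => memSOn (seg o s) ∪ memDOn (seg o s)
  | _, _ => memAll ∪ unknown pio io ∪ unknown pis is

/-- The number of additional nodes for the memory effects of a call. -/
def nodeOffset (pio pis poo pos : Option Word) : ℕ :=
  match pio, pis, poo, pos with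
  | some _, some _, some _, some s => s.val
  | some _, some _, _, _ => 2 ^ 256 - 1
  | _, _, some _, some _ => 1
  | _, _, _, _ => 0

/-- The nodes of a call which write the new memory contents to temporal variables; `A` is the
set of variables on which the outcome of the call depends. -/
def callMemEdges (A : Set Var) (pio pis poo pos : Option Word) : Set CfgEdge :=
  match pio, pis, poo, pos with
  | some _, some _, some o, some s =>
      {e | ∃ k < s.val, e = ⟨3 + k, tmemSOn {l | l.val = o.val + k},
        A ∪ memSOn {l | l.val = o.val + k} ∪ memDOn {l | l.val = o.val + k}, .sub (4 + k)⟩} ∪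
      {⟨3 + s.val, tmemDOn (seg o s), ∅, .sub (4 + s.val)⟩}
  | some _, some _, _, _ =>
      {e | ∃ l : Word, e = ⟨3 + l.val, tmemDOn {l}, A ∪ memSOn {l} ∪ memDOn {l},
        .sub (4 + l.val)⟩}
  | _, _, some o, some s =>
      {⟨3, tmemSOn (seg o s), A, .sub 4⟩, ⟨4, tmemDOn (seg o s), ∅, .sub 5⟩}
  | _, _, _, _ => {⟨3, tmemDOn Set.univ, A, .sub 4⟩}

/-- The nodes of a call, from index `b` on, which copy the temporal memory variables back. -/
def callCopyBackEdges (b : ℕ) (pio pis poo pos : Option Word) : Set CfgEdge :=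
  match pio, pis, poo, pos with
  | some _, some _, some o, some s =>
      {e | ∃ k < s.val, e = ⟨b + k, memSOn {l | l.val = o.val + k},
        tmemSOn {l | l.val = o.val + k}, .sub (b + k + 1)⟩} ∪
      {⟨b + s.val, memDOn (seg o s), tmemDOn (seg o s), .sub (b + s.val + 1)⟩}
  | some _, some _, _, _ =>
      {e | ∃ l : Word, e = ⟨b + l.val, memDOn {l}, tmemDOn {l}, .sub (b + l.val + 1)⟩}
  | _, _, some o, some s =>
      {⟨b, memSOn (seg o s), tmemSOn (seg o s), .sub (b + 1)⟩,
        ⟨b + 1, memDOn (seg o s), tmemDOn (seg o s), .sub (b + 2)⟩}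
  | _, _, _, _ => {⟨b, memDyn, tmemDOn Set.univ, .sub (b + 1)⟩}

/-- The edges of a call with result variable `y`, further arguments `args`, memory arguments
`io`, `is`, `oo`, `os` and their precomputed values. `D` is written by the node for the outcome of
the call. -/
def callEdges (D : Set Var) (y : ℕ) (args : Set Var) (io is oo os : ℕ)
    (pio pis poo pos : Option Word) : Set CfgEdge :=
  let A : Set Var := args ∪ {gasV, .perm (.loc .actor)} ∪ globAll ∪ storAll ∪
    inputFragment pio pis io is ∪ unknown poo oo ∪ unknown pos os
  let reset := 4 + nodeOffset pio pis poo pos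
  {⟨0, D, A, .sub 1⟩,
    ⟨1, {.temp (.loc .gas)}, A ∪ {msizeV}, .sub 2⟩,
    ⟨2, {.temp (.loc .msize)},
      {msizeV} ∪ unknown pio io ∪ unknown pis is ∪ unknown poo oo ∪ unknown pos os, .sub 3⟩} ∪
  callMemEdges A pio pis poo pos ∪
  {⟨reset, {stk y, externalV}, {.temp (.stack y), .temp (.glob .external)}, .sub (reset + 1)⟩,
    ⟨reset + 1, {gasV}, {.temp (.loc .gas)}, .sub (reset + 2)⟩,
    ⟨reset + 2, {msizeV}, {.temp (.loc .msize)}, .sub (reset + 3)⟩} ∪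
  callCopyBackEdges (reset + 3) pio pis poo pos ∪
  {⟨2 * reset, tempAll, ∅, .next⟩}

/-- The edges of a contract creation with result variable `y`, further arguments `args`, and the
memory fragment `io`, `is` holding the initialization code. -/
def createEdges (y : ℕ) (args : Set Var) (io is : ℕ) (pio pis : Option Word) : Set CfgEdge :=
  let A : Set Var := args ∪ {gasV, .perm (.loc .actor)} ∪ globAll ∪ storAll ∪
    inputFragment pio pis io is
  {⟨0, {.temp (.stack y), .temp (.glob .external)}, A, .sub 1⟩,
    ⟨1, {.temp (.loc .gas)}, A ∪ {msizeV}, .sub 2⟩,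
    ⟨2, {.temp (.loc .msize)}, {msizeV} ∪ unknown pio io ∪ unknown pis is, .sub 3⟩,
    ⟨3, {stk y, externalV}, {.temp (.stack y), .temp (.glob .external)}, .sub 4⟩,
    ⟨4, {gasV}, {.temp (.loc .gas)}, .sub 5⟩,
    ⟨5, {msizeV}, {.temp (.loc .msize)}, .sub 6⟩,
    ⟨6, tempAll, ∅, .next⟩}

/-- The CFG edges for an instruction with given precomputed argument values. -/
def instrEdges : Instr → Pre → Set CfgEdge
  | .bin _ y x₁ x₂, _ => assignEdges y {stk x₁, stk x₂} ∅
  | .EXP y x₁ x₂, _ => assignEdges y {stk x₁, stk x₂} {stk x₂}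
  | .SHA3 y x₁ x₂, _ =>
      {⟨0, {stk y}, {stk x₁, stk x₂} ∪ memAll, .sub 1⟩,
        ⟨1, {gasV}, {gasV, msizeV, stk x₁, stk x₂}, .sub 2⟩,
        ⟨2, {msizeV}, {msizeV, stk x₁, stk x₂}, .next⟩}
  | .un _ y x, _ => assignEdges y {stk x} ∅
  | .tern _ y x₁ x₂ x₃, _ => assignEdges y {stk x₁, stk x₂, stk x₃} ∅
  | .ASSIGN y x, _ => assignEdges y {stk x} ∅
  | .ADDRESS y, _ => assignEdges y {.perm (.loc .actor)} ∅
  | .CALLER y, _ => assignEdges y {.perm (.loc .sender)} ∅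
  | .CALLVALUE y, _ => assignEdges y {.perm (.loc .value)} ∅
  | .CODESIZE y, _ => assignEdges y {.perm (.loc .code)} ∅
  | .CALLDATASIZE y, _ => assignEdges y {.perm (.loc .input)} ∅
  | .CALLDATALOAD y x, _ => assignEdges y {.perm (.loc .input), stk x} ∅
  | .CALLDATACOPY x₁ x₂ x₃, _ =>
      copyEdges {.perm (.loc .input), stk x₁, stk x₂, stk x₃} {stk x₁, stk x₂, stk x₃}
        {stk x₁, stk x₃}
  | .CODECOPY x₁ x₂ x₃, _ =>
      copyEdges {.perm (.loc .code), stk x₁, stk x₂, stk x₃} {stk x₁, stk x₂, stk x₃}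
        {stk x₁, stk x₃}
  | .ORIGIN y, _ => assignEdges y {.perm (.glob .origin)} ∅
  | .GASPRICE y, _ => assignEdges y {.perm (.glob .prize)} ∅
  | .COINBASE y, _ => assignEdges y {.perm (.glob .beneficiary)} ∅
  | .TIMESTAMP y, _ => assignEdges y {.perm (.glob .timestamp)} ∅
  | .NUMBER y, _ => assignEdges y {.perm (.glob .number)} ∅
  | .GASLIMIT y, _ => assignEdges y {.perm (.glob .gaslimit)} ∅
  | .DIFFICULTY y, _ => assignEdges y {.perm (.glob .difficulty)} ∅
  | .BLOCKHASH y x, _ => assignEdges y {.perm (.glob .parent), stk x} ∅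
  | .BALANCE y x, _ => assignEdges y {externalV, stk x} ∅
  | .EXTCODESIZE y x, _ => assignEdges y {externalV, stk x} ∅
  | .EXTCODECOPY x₁ x₂ x₃ x₄, _ =>
      copyEdges {externalV, stk x₁, stk x₂, stk x₃, stk x₄} {stk x₂, stk x₃, stk x₄}
        {stk x₂, stk x₄}
  | .JUMP _, p => {e | ∃ d, p 0 = some d ∧ e = ⟨0, {gasV}, {gasV}, .jump d⟩}
  | .JUMPI _ x₂, p =>
      {e | ∃ d, p 0 = some d ∧
        (e = ⟨0, {gasV}, {gasV}, .sub 1⟩ ∨ e = ⟨1, ∅, {stk x₂}, .next⟩ ∨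
          e = ⟨1, ∅, {stk x₂}, .jump d⟩)}
  | .MLOAD y x, p =>
      {⟨0, {stk y}, match p 1 with
          | none => memAll ∪ {stk x}
          | some l => memSOn {l} ∪ memDOn {l}, .sub 1⟩,
        ⟨1, {gasV}, {gasV, msizeV, stk x}, .sub 2⟩,
        ⟨2, {msizeV}, {msizeV, stk x}, .next⟩}
  | .MSTORE x₁ x₂, p =>
      (match p 0 with
        | none => {⟨0, memDyn, memDyn ∪ {stk x₁, stk x₂}, .sub 2⟩}
        | some l => {⟨0, memSOn {l}, {stk x₂}, .sub 1⟩, ⟨1, memDOn {l}, ∅, .sub 2⟩}) ∪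
      {⟨2, {gasV}, {gasV, msizeV, stk x₁}, .sub 3⟩, ⟨3, {msizeV}, {msizeV, stk x₁}, .next⟩}
  | .SLOAD y x, p =>
      assignEdges y (match p 1 with
        | none => storAll ∪ {stk x}
        | some l => {.perm (.storS l), .perm (.storD l)}) ∅
  | .SSTORE x₁ x₂, p =>
      (match p 0 with
        | none => {⟨0, storDyn, storDyn ∪ {stk x₁, stk x₂}, .sub 2⟩}
        | some l => {⟨0, {.perm (.storS l)}, {stk x₂}, .sub 1⟩,
            ⟨1, {.perm (.storD l)}, ∅, .sub 2⟩}) ∪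
      {⟨2, {gasV}, {gasV, stk x₁, stk x₂} ∪ storAll, .next⟩}
  | .GAS y, _ => assignEdges y {gasV} ∅
  | .PC y, _ => assignEdges y ∅ ∅
  | .MSIZE y, _ => assignEdges y {msizeV} ∅
  | .LOG x₁ x₂ _, _ =>
      {⟨0, {gasV}, {gasV, msizeV, stk x₁, stk x₂}, .sub 1⟩,
        ⟨1, {msizeV}, {msizeV, stk x₁, stk x₂}, .next⟩}
  | .RETURN x₁ x₂, _ =>
      {⟨0, {gasV}, {gasV, msizeV, stk x₁, stk x₂}, .sub 1⟩,
        ⟨1, {msizeV}, {msizeV, stk x₁, stk x₂}, .halt⟩}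
  | .STOP, _ => {⟨0, ∅, ∅, .halt⟩}
  | .INVALID, _ => {⟨0, ∅, ∅, .exception⟩}
  | .SELFDESTRUCT x, _ =>
      {⟨0, {externalV}, {externalV, stk x, .perm (.loc .actor)}, .sub 1⟩,
        ⟨1, {gasV}, {externalV, stk x, gasV}, .halt⟩}
  | .CALL y g rcv va io is oo os, p =>
      callEdges {.temp (.stack y), .temp (.glob .external)} y {stk g, stk rcv, stk va}
        io is oo os (p 4) (p 5) (p 6) (p 7)
  | .STATICCALL y g rcv io is oo os, p =>
      callEdges {.temp (.stack y)} y {stk g, stk rcv} io is oo os (p 3) (p 4) (p 5) (p 6)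
  | .CREATE y va io is, p => createEdges y {stk va} io is (p 2) (p 3)
  | .CREATE2 y va salt io is, p => createEdges y {stk va, stk salt} io is (p 3) (p 4)

/-- CFG nodes: the subnodes `(pc, i)`, the nodes for regular and exceptional halting, and the
exit node. -/
inductive Node
  | inner (pc : Word) (i : ℕ)
  | halt
  | exception
  | exit

/-- The node reached by an edge of the instruction at `pc` with next program counter `pcn`. -/
def Target.node (pc pcn : Word) : Target → Node
  | .sub j => .inner pc j
  | .next => .inner pcn 0
  | .jump d => .inner d 0
  | .halt => .halt
  | .exception => .exception

/-- `e` is an edge of the CFG of `C` at program counter `pc`, with target node `t`. -/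
def IsEdgeAt (C : Contract) (pc : Word) (e : CfgEdge) (t : Node) : Prop :=
  ∃ ins pcn pre, C pc = some (ins, pcn, pre) ∧ e ∈ instrEdges ins pre ∧ t = e.tgt.node pc pcn

/-- The edges of the control flow graph of `C`. -/
inductive Edge (C : Contract) : Node → Node → Prop
  | instr {pc : Word} {e : CfgEdge} {t : Node} (h : IsEdgeAt C pc e t) :
      Edge C (.inner pc e.src) t
  | halt : Edge C .halt .exit
  | exception : Edge C .exception .exit

/-- The variables written at a node. -/
def Def (C : Contract) (n : Node) : Set Var :=
  {v | ∃ pc e t, IsEdgeAt C pc e t ∧ n = .inner pc e.src ∧ v ∈ e.defs}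

/-- The variables read at a node. -/
def Use (C : Contract) (n : Node) : Set Var :=
  {v | ∃ pc e t, IsEdgeAt C pc e t ∧ n = .inner pc e.src ∧ v ∈ e.uses}

/-! ### The program dependence graph and backward slices -/

/-- Data dependence of `n'` on `n`: `n` writes a variable that `n'` reads, and `n'` is reachable
from `n` by a nonempty path, with no node strictly in between writing that variable. -/
def DataDep (C : Contract) (n n' : Node) : Prop :=
  ∃ v, v ∈ Def C n ∧ v ∈ Use C n' ∧
    ∃ l : List Node, List.IsChain (Edge C) (n :: (l ++ [n'])) ∧ ∀ m ∈ l, v ∉ Def C m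

/-- `m` can reach the exit node without passing through `n'`. -/
def CanAvoid (C : Contract) (n' m : Node) : Prop :=
  m ≠ n' ∧ Relation.ReflTransGen (fun a b => Edge C a b ∧ b ≠ n') m .exit

/-- Standard control dependence of `n'` on `n`: `n` can reach the exit without passing through
`n'`, and there is a path from `n` to `n'` all of whose other nodes cannot. -/
def ControlDep (C : Contract) (n n' : Node) : Prop :=
  CanAvoid C n' n ∧
    ∃ l : List Node, List.IsChain (Edge C) (n :: (l ++ [n'])) ∧
      ∀ m ∈ l, m ≠ n → ¬ CanAvoid C n' m

/-- The backward slice of `n`: all nodes that can reach `n` in the program dependence graph. -/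
def BS (C : Contract) (n : Node) : Set Node :=
  {m | Relation.ReflTransGen (fun a b => DataDep C a b ∨ ControlDep C a b) m n}

/-! ### Constrained Horn clauses for the dependency predicates -/

/-- Ground facts over the dependency predicates. -/
inductive Fact
  /-- `y` is written at `n`, reading `z` -/
  | localDep (n : Node) (y z : Var)
  /-- `y` is written at `n` -/
  | writes (n : Node) (y : Var)
  /-- `n` is control dependent on `b`, which has condition variable `z` -/
  | controls (n b : Node) (z : Var)
  /-- `n` is transitively controlled by `b`, which has condition variable `z` -/
  | mayControls (n b : Node) (z : Var)
  /-- the value of `y` right after `n` may depend on `x` -/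
  | mayDependOnAt (n : Node) (y x : Var)
  /-- the value of `y` may depend on `x` -/
  | varMayDepOn (y x : Var)
  /-- the reachability of `n` may depend on `x` -/
  | instMayDepOn (n : Node) (x : Var)

/-- A ground Horn clause. -/
structure HornClause where
  body : Set Fact
  head : Fact

/-- The rule set of the contract `C`, with clauses `body ⇒ head`. -/
inductive Rules (C : Contract) : Set HornClause
  /-- local dependencies: the cross product of the Def and the Use set of each node -/
  | localDep {n y z} : y ∈ Def C n → z ∈ Use C n → Rules C ⟨∅, .localDep n y z⟩
  | writes {n y} : y ∈ Def C n → Rules C ⟨∅, .writes n y⟩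
  /-- control dependence and its transitive closure -/
  | controls {n b z} : ControlDep C b n → z ∈ Use C b → Rules C ⟨∅, .controls n b z⟩
  | mayControls {n b z} : Rules C ⟨{.controls n b z}, .mayControls n b z⟩
  | mayControlsTrans {n b z b' z'} :
      Rules C ⟨{.controls n b z, .mayControls b b' z'}, .mayControls n b' z'⟩
  /-- sources: the variables written and read at a node -/
  | sourceWrite {n y x} : Rules C ⟨{.writes n y, .writes n x}, .mayDependOnAt n y x⟩
  | sourceRead {n y x} : Rules C ⟨{.localDep n y x}, .mayDependOnAt n y x⟩
  /-- propagation through a read of a stack variable, whose dependencies are not indexed -/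
  | stackRead {n y z x} : z.IsStack →
      Rules C ⟨{.localDep n y z, .varMayDepOn z x}, .mayDependOnAt n y x⟩
  /-- propagation through a read of another variable, from the preceding node -/
  | stateRead {m n y z x} : Edge C m n → ¬ z.IsStack →
      Rules C ⟨{.localDep n y z, .mayDependOnAt m z x}, .mayDependOnAt n y x⟩
  /-- propagation to the following node if the variable is not reassigned there -/
  | noReassign {m n y x} : Edge C m n → y ∉ Def C n →
      Rules C ⟨{.mayDependOnAt m y x}, .mayDependOnAt n y x⟩
  /-- a variable written under control of a branch depends on the branching condition -/
  | control {n y b z x} :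
      Rules C ⟨{.writes n y, .mayControls n b z, .varMayDepOn z x}, .mayDependOnAt n y x⟩
  | varMayDepOn {n y x} : Rules C ⟨{.mayDependOnAt n y x}, .varMayDepOn y x⟩
  /-- so does the reachability of a node controlled by the branch -/
  | instMayDepOnCond {n b x} : Rules C ⟨{.mayControls n b x}, .instMayDepOn n x⟩
  | instMayDepOn {n b z x} :
      Rules C ⟨{.mayControls n b z, .varMayDepOn z x}, .instMayDepOn n x⟩

/-- The immediate consequence operator of a set of ground Horn clauses. -/
def immediateConsequence (R : Set HornClause) : Set Fact →o Set Fact where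
  toFun S := {f | ∃ c ∈ R, c.body ⊆ S ∧ c.head = f}
  monotone' := fun _ _ hST _ ⟨c, hc, hb, hf⟩ => ⟨c, hc, hb.trans hST, hf⟩

/-- The least fixpoint of a set of ground Horn clauses. -/
def lfp (R : Set HornClause) : Set Fact := OrderHom.lfp (immediateConsequence R)

end EVM

/-! A backward slice is a path in the dependence graph, and the proof is an induction along that
path, turning every dependence edge into an application of clauses. Let `x` be written at the start
of the path. For a node `n` on it that writes something, the invariant is `mayDependOnAt n y x` for
each `y` in `Def C n`.

A data dependence edge preserves this: the fact for the transported variable `v` passes along the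
definition-free path by `noReassign`, and the read at the end is covered by `stackRead` or
`stateRead`. This is `exists_pred_mayDependOnAt`.

A control dependence edge needs more, because its source writes nothing and so the invariant says
nothing there. For nodes with empty `Def` the invariant is therefore `ConditionDependsOn`: either a
variable read there, or the condition of some branch controlling the node, may depend on `x`.
`ControlDep.exists_mayControls` passes this across a control dependence.

The graph-theoretic input is that the source of a control dependence has two successors, and that in
this CFG only the second subnode of a JUMPI does. That subnode has empty `Def` and nonempty `Use`;
both facts are needed, and the determinism lemmas for the instructions serve to establish them. -/

namespace EVM

/-! ### Determinism of the edges of an instruction -/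

/-- The target of an edge is determined by its source. -/
def Deterministic (E : Set CfgEdge) : Prop :=
  ∀ e₁ ∈ E, ∀ e₂ ∈ E, e₁.src = e₂.src → e₁.tgt = e₂.tgt

/-- `e` leads to the next subnode if it starts below `N`, and to the next instruction if it starts
at `N`. -/
def IsSequential (N : ℕ) (e : CfgEdge) : Prop :=
  (e.src < N ∧ e.tgt = .sub (e.src + 1)) ∨ (e.src = N ∧ e.tgt = .next)

theorem deterministic_of_isSequential {E : Set CfgEdge} {N : ℕ}
    (h : ∀ e ∈ E, IsSequential N e) : Deterministic E := by
  intro e₁ h₁ e₂ h₂ hs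
  rcases h e₁ h₁ with ⟨a, b⟩ | ⟨a, b⟩ <;> rcases h e₂ h₂ with ⟨c, d⟩ | ⟨c, d⟩
  · rw [b, d, hs]
  · omega
  · omega
  · rw [b, d]

/-- The bound is the index at which the copying of results back starts in `callEdges`, so the memory
step stays strictly before it. When only the input fragment is known, there is one subnode per word,
and the last one, `3 + (2 ^ 256 - 1)`, just fits. -/
theorem callMemEdges_src_tgt {A : Set Var} {pio pis poo pos : Option Word} {e : CfgEdge}
    (he : e ∈ callMemEdges A pio pis poo pos) :
    e.src < 4 + nodeOffset pio pis poo pos ∧ e.tgt = .sub (e.src + 1) := by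
  rcases pio with _ | pio <;> rcases pis with _ | pis <;> rcases poo with _ | poo <;>
    rcases pos with _ | pos <;>
    simp only [callMemEdges, nodeOffset, Set.mem_union, Set.mem_ofPred_eq, Set.mem_insert_iff,
      Set.mem_singleton_iff] at he ⊢
  all_goals
    first
    | (rcases he with ⟨k, hk, rfl⟩ | rfl <;> refine ⟨?_, congrArg Target.sub ?_⟩ <;> dsimp only <;> omega)
    | (obtain ⟨l, rfl⟩ := he
       have := l.isLt
       refine ⟨?_, congrArg Target.sub ?_⟩ <;> dsimp only <;> omega)

/-- The copy step has at most `1 + nodeOffset` subnodes. For `b = 7 + nodeOffset`, as used in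
`callEdges`, the bound becomes `2 * (4 + nodeOffset)`, the index of the final subnode that resets
the temporal variables. -/
theorem callCopyBackEdges_src_tgt {b : ℕ} {pio pis poo pos : Option Word} {e : CfgEdge}
    (he : e ∈ callCopyBackEdges b pio pis poo pos) :
    e.src < b + 1 + nodeOffset pio pis poo pos ∧ e.tgt = .sub (e.src + 1) := by
  rcases pio with _ | pio <;> rcases pis with _ | pis <;> rcases poo with _ | poo <;>
    rcases pos with _ | pos <;>
    simp only [callCopyBackEdges, nodeOffset, Set.mem_union, Set.mem_ofPred_eq, Set.mem_insert_iff,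
      Set.mem_singleton_iff] at he ⊢
  all_goals
    first
    | (rcases he with ⟨k, hk, rfl⟩ | rfl <;> refine ⟨?_, congrArg Target.sub ?_⟩ <;> dsimp only <;> omega)
    | (obtain ⟨l, rfl⟩ := he
       have := l.isLt
       refine ⟨?_, congrArg Target.sub ?_⟩ <;> dsimp only <;> omega)

theorem callEdges_deterministic (D : Set Var) (y : ℕ) (args : Set Var) (io is oo os : ℕ)
    (pio pis poo pos : Option Word) :
    Deterministic (callEdges D y args io is oo os pio pis poo pos) := by
  refine deterministic_of_isSequential (N := 2 * (4 + nodeOffset pio pis poo pos)) fun e he => ?_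
  rcases he with (((he | he) | he) | he) | he
  · rcases he with rfl | rfl | rfl <;> exact .inl ⟨by dsimp only; omega, rfl⟩
  · obtain ⟨h, ht⟩ := callMemEdges_src_tgt he
    exact .inl ⟨by omega, ht⟩
  · rcases he with rfl | rfl | rfl <;> exact .inl ⟨by dsimp only; omega, rfl⟩
  · obtain ⟨h, ht⟩ := callCopyBackEdges_src_tgt he
    exact .inl ⟨by omega, ht⟩
  · obtain rfl := Set.mem_singleton_iff.1 he
    exact .inr ⟨rfl, rfl⟩

theorem createEdges_deterministic (y : ℕ) (args : Set Var) (io is : ℕ) (pio pis : Option Word) :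
    Deterministic (createEdges y args io is pio pis) := by
  refine deterministic_of_isSequential (N := 6) fun e he => ?_
  rcases he with rfl | rfl | rfl | rfl | rfl | rfl | he
  all_goals first | exact .inl ⟨by norm_num, rfl⟩ | skip
  obtain rfl := Set.mem_singleton_iff.1 he
  exact .inr ⟨rfl, rfl⟩

theorem assignEdges_deterministic (y : ℕ) (U G : Set Var) :
    Deterministic (assignEdges y U G) := by
  refine deterministic_of_isSequential (N := 1) fun e he => ?_
  rcases he with rfl | rfl
  exacts [.inl ⟨Nat.zero_lt_one, rfl⟩, .inr ⟨rfl, rfl⟩]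

theorem copyEdges_deterministic (U G M : Set Var) : Deterministic (copyEdges U G M) := by
  refine deterministic_of_isSequential (N := 2) fun e he => ?_
  rcases he with rfl | rfl | rfl
  exacts [.inl ⟨by norm_num, rfl⟩, .inl ⟨by norm_num, rfl⟩, .inr ⟨rfl, rfl⟩]

/-- `IsSequential` fails here: for an unknown location, subnode 0 leads directly to subnode 2. Hence
the comparison of edges case by case; the same applies to SSTORE. -/
theorem mstoreEdges_deterministic (x₁ x₂ : ℕ) (p : Pre) :
    Deterministic (instrEdges (.MSTORE x₁ x₂) p) := by
  intro e₁ h₁ e₂ h₂ hs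
  rw [instrEdges] at h₁ h₂
  cases h : p 0 <;>
    simp only [h, Set.mem_union, Set.mem_insert_iff, Set.mem_singleton_iff] at h₁ h₂
  · rcases h₁ with rfl | rfl | rfl <;> rcases h₂ with rfl | rfl | rfl <;> simp_all
  · rcases h₁ with (rfl | rfl) | rfl | rfl <;> rcases h₂ with (rfl | rfl) | rfl | rfl <;> simp_all

theorem sstoreEdges_deterministic (x₁ x₂ : ℕ) (p : Pre) :
    Deterministic (instrEdges (.SSTORE x₁ x₂) p) := by
  intro e₁ h₁ e₂ h₂ hs
  rw [instrEdges] at h₁ h₂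
  cases h : p 0 <;>
    simp only [h, Set.mem_union, Set.mem_insert_iff, Set.mem_singleton_iff] at h₁ h₂
  · rcases h₁ with rfl | rfl <;> rcases h₂ with rfl | rfl <;> simp_all
  · rcases h₁ with (rfl | rfl) | rfl <;> rcases h₂ with (rfl | rfl) | rfl <;> simp_all

/-- The only instructions with branching nodes are conditional jumps. -/
theorem instrEdges_deterministic (ins : Instr) (p : Pre)
    (h : ∀ x₁ x₂, ins ≠ .JUMPI x₁ x₂) : Deterministic (instrEdges ins p) := by
  cases ins with
  | JUMPI x₁ x₂ => exact absurd rfl (h x₁ x₂)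
  | MSTORE x₁ x₂ => exact mstoreEdges_deterministic x₁ x₂ p
  | SSTORE x₁ x₂ => exact sstoreEdges_deterministic x₁ x₂ p
  | JUMP x =>
    rintro _ ⟨d₁, h₁, rfl⟩ _ ⟨d₂, h₂, rfl⟩ -
    rw [h₁] at h₂
    exact congrArg Target.jump (Option.some.inj h₂)
  | _ =>
    first
    | exact assignEdges_deterministic _ _ _
    | exact copyEdges_deterministic _ _ _
    | exact callEdges_deterministic _ _ _ _ _ _ _ _ _ _ _
    | exact createEdges_deterministic _ _ _ _ _ _
    | (intro e₁ h₁ e₂ h₂ hs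
       simp only [instrEdges, Set.mem_insert_iff, Set.mem_singleton_iff] at h₁ h₂
       first
       | rw [h₁, h₂]
       | (rcases h₁ with rfl | rfl <;> rcases h₂ with rfl | rfl <;> simp_all)
       | (rcases h₁ with rfl | rfl | rfl <;> rcases h₂ with rfl | rfl | rfl <;> simp_all))

/-! ### Branching nodes -/

/-- A node with two different successors writes nothing and reads some variable. -/
theorem def_eq_empty_and_use_nonempty_of_edge_ne {C : Contract} {b s t : Node}
    (hs : Edge C b s) (ht : Edge C b t) (hst : s ≠ t) :
    Def C b = ∅ ∧ (Use C b).Nonempty := by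
  cases hs with
  | halt => cases ht; exact absurd rfl hst
  | exception => cases ht; exact absurd rfl hst
  | @instr pc e _ hs =>
    generalize hb : Node.inner pc e.src = b at ht
    cases ht with
    | halt => cases hb
    | exception => cases hb
    | @instr pc' e' _ ht =>
      obtain ⟨rfl, hsrc⟩ := Node.inner.inj hb
      obtain ⟨ins, pcn, p, hC, he, rfl⟩ := id hs
      obtain ⟨ins', pcn', p', hC', he', rfl⟩ := ht
      obtain ⟨rfl, rfl, rfl⟩ : ins = ins' ∧ pcn = pcn' ∧ p = p' := by
        simpa [hC] using hC'
      have htgt : e.tgt ≠ e'.tgt := fun h => hst (by rw [h])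
      obtain ⟨x₁, x₂, rfl⟩ : ∃ x₁ x₂, ins = .JUMPI x₁ x₂ := by
        by_contra! hj
        exact htgt (instrEdges_deterministic ins p hj e he e' he' hsrc)
      -- Of the JUMPI subnodes, the gas subnode 0 has the single target `.sub 1`, so differing
      -- targets force the source to be subnode 1, which reads the condition.
      obtain ⟨hsrc1, huse⟩ : e.src = 1 ∧ stk x₂ ∈ e.uses := by
        obtain ⟨d, -, rfl | rfl | rfl⟩ := he
        · obtain ⟨d', -, rfl | rfl | rfl⟩ := he'
          · exact absurd rfl htgt
          · cases hsrc
          · cases hsrc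
        · exact ⟨rfl, rfl⟩
        · exact ⟨rfl, rfl⟩
      rw [← hb]
      refine ⟨Set.eq_empty_of_forall_notMem ?_, stk x₂, pc, e, _, hs, rfl, huse⟩
      -- `Def` collects over every edge leaving the node. The gas edge is excluded by its source
      -- index, and both branch edges define nothing.
      rintro v ⟨pc'', f, _, ⟨ins, _, _, hC'', hf, -⟩, hn, hv⟩
      obtain ⟨rfl, hsrcf⟩ := Node.inner.inj hn
      simp only [hC, Option.some.injEq, Prod.mk.injEq] at hC''
      obtain ⟨rfl, rfl, rfl⟩ := hC''
      obtain ⟨d, -, rfl | rfl | rfl⟩ := hf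
      · dsimp only at hsrcf; omega
      · exact hv
      · exact hv

/-- The source of a control dependence has two different successors. -/
theorem ControlDep.exists_edge_ne {C : Contract} {b n : Node} (h : ControlDep C b n) :
    ∃ s t, Edge C b s ∧ Edge C b t ∧ s ≠ t := by
  obtain ⟨⟨hbn, havoid⟩, l, hchain, hl⟩ := h
  -- If `b` had only one successor, the path to `n` and the path to the exit avoiding `n` would
  -- start with the same step.
  by_contra! hdet
  obtain ⟨c, hbc, hc⟩ : ∃ c, Edge C b c ∧ (c = n ∨ c ∈ l) := by
    cases l with
    | nil => exact ⟨n, (List.isChain_cons_cons.1 hchain).1, .inl rfl⟩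
    | cons c l => exact ⟨c, (List.isChain_cons_cons.1 hchain).1, .inr (by simp)⟩
  rcases havoid.cases_head with rfl | ⟨a, ⟨hba, han⟩, hae⟩
  -- Here `b` is the exit node, which has no outgoing edge.
  · cases hbc
  · obtain rfl := hdet a c hba hbc
    have hal := hc.resolve_left han
    -- The condition on the inner nodes of the path exempts occurrences of `b`, so a self-loop has
    -- to be excluded separately: a node whose only successor is itself never reaches the exit.
    by_cases hab : a = b
    · subst hab
      have hstay : ∀ m, Relation.ReflTransGen (fun u v => Edge C u v ∧ v ≠ n) a m → m = a := by
        intro m hm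
        induction hm with
        | refl => rfl
        | tail _ h ih => subst ih; exact hdet _ _ h.1 hba
      have := hstay _ hae
      subst this
      cases hba
    · exact hl a hal hab ⟨han, hae⟩

theorem ControlDep.def_eq_empty {C : Contract} {b n : Node} (h : ControlDep C b n) :
    Def C b = ∅ :=
  let ⟨_, _, hs, ht, hst⟩ := h.exists_edge_ne
  (def_eq_empty_and_use_nonempty_of_edge_ne hs ht hst).1

/-- A `controls` fact exists only together with a condition variable. With an empty `Use C b`, the
clause `mayControlsTrans` could not pass through `b`, and chains of control dependences would break
there. -/
theorem ControlDep.use_nonempty {C : Contract} {b n : Node} (h : ControlDep C b n) :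
    (Use C b).Nonempty :=
  let ⟨_, _, hs, ht, hst⟩ := h.exists_edge_ne
  (def_eq_empty_and_use_nonempty_of_edge_ne hs ht hst).2

/-! ### Derivations in the least fixpoint -/

theorem mem_lfp_of_rule {R : Set HornClause} {body : Set Fact} {head : Fact}
    (h : R ⟨body, head⟩) (hb : body ⊆ lfp R) : head ∈ lfp R := by
  have : head ∈ immediateConsequence R (lfp R) := ⟨_, h, hb, rfl⟩
  rwa [lfp, OrderHom.map_lfp] at this

theorem mem_lfp_of_rule_one {R : Set HornClause} {f head : Fact}
    (h : R ⟨{f}, head⟩) (hf : f ∈ lfp R) : head ∈ lfp R :=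
  mem_lfp_of_rule h (Set.singleton_subset_iff.2 hf)

theorem mem_lfp_of_rule_two {R : Set HornClause} {f g head : Fact}
    (h : R ⟨{f, g}, head⟩) (hf : f ∈ lfp R) (hg : g ∈ lfp R) : head ∈ lfp R :=
  mem_lfp_of_rule h (Set.insert_subset hf (Set.singleton_subset_iff.2 hg))

theorem mem_lfp_of_rule_three {R : Set HornClause} {f g k head : Fact}
    (h : R ⟨{f, g, k}, head⟩) (hf : f ∈ lfp R) (hg : g ∈ lfp R) (hk : k ∈ lfp R) :
    head ∈ lfp R :=
  mem_lfp_of_rule h (Set.insert_subset hf (Set.insert_subset hg (Set.singleton_subset_iff.2 hk)))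

variable {C : Contract}

theorem writes_mem_lfp {n : Node} {y : Var} (hy : y ∈ Def C n) :
    Fact.writes n y ∈ lfp (Rules C) :=
  mem_lfp_of_rule (.writes hy) (Set.empty_subset _)

theorem localDep_mem_lfp {n : Node} {y z : Var} (hy : y ∈ Def C n) (hz : z ∈ Use C n) :
    Fact.localDep n y z ∈ lfp (Rules C) :=
  mem_lfp_of_rule (.localDep hy hz) (Set.empty_subset _)

theorem controls_mem_lfp {n b : Node} {z : Var} (h : ControlDep C b n) (hz : z ∈ Use C b) :
    Fact.controls n b z ∈ lfp (Rules C) :=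
  mem_lfp_of_rule (.controls h hz) (Set.empty_subset _)

/-- A dependency of `v` is propagated along a path whose inner nodes do not write `v` to a
predecessor of the last node. -/
theorem exists_pred_mayDependOnAt {v x : Var} {n' : Node} (l : List Node) :
    ∀ n, List.IsChain (Edge C) (n :: (l ++ [n'])) → (∀ m ∈ l, v ∉ Def C m) →
      Fact.mayDependOnAt n v x ∈ lfp (Rules C) →
      ∃ m, Edge C m n' ∧ Fact.mayDependOnAt m v x ∈ lfp (Rules C) := by
  induction l with
  | nil => exact fun n hc _ hn => ⟨n, (List.isChain_cons_cons.1 hc).1, hn⟩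
  | cons c l ih =>
    intro n hc hl hn
    obtain ⟨hnc, hc⟩ := List.isChain_cons_cons.1 hc
    exact ih c hc (fun m hm => hl m (List.mem_cons_of_mem _ hm))
      (mem_lfp_of_rule_one (.noReassign hnc (hl c List.mem_cons_self)) hn)

/-- The execution of `n` is determined by data that may depend on `x`: a variable read at `n`, or
the condition of a branch that controls `n`. -/
def ConditionDependsOn (C : Contract) (n : Node) (x : Var) : Prop :=
  (∃ z ∈ Use C n, Fact.varMayDepOn z x ∈ lfp (Rules C)) ∨
    ∃ b z, Fact.mayControls n b z ∈ lfp (Rules C) ∧ Fact.varMayDepOn z x ∈ lfp (Rules C)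

/-- If the dependence on `x` comes from a variable read at `b`, then `b` itself is the controlling
branch. If it comes from a branch controlling `b`, transitivity makes that branch control `n`; the
condition variable of `b` is then arbitrary. -/
theorem ControlDep.exists_mayControls {b n : Node} {x : Var} (h : ControlDep C b n)
    (hb : ConditionDependsOn C b x) :
    ∃ b' z, Fact.mayControls n b' z ∈ lfp (Rules C) ∧ Fact.varMayDepOn z x ∈ lfp (Rules C) := by
  rcases hb with ⟨z, hz, hzx⟩ | ⟨b', z', hc, hzx⟩
  · exact ⟨b, z, mem_lfp_of_rule_one .mayControls (controls_mem_lfp h hz), hzx⟩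
  · obtain ⟨z, hz⟩ := h.use_nonempty
    exact ⟨b', z', mem_lfp_of_rule_two .mayControlsTrans (controls_mem_lfp h hz) hc, hzx⟩

/-- All nodes with `m` in their backward slice inherit the dependencies on the variables written
at `m`. -/
theorem mayDependOnAt_of_mem_BS {m n : Node} {x : Var} (hx : x ∈ Def C m) (h : m ∈ BS C n) :
    (∀ y ∈ Def C n, Fact.mayDependOnAt n y x ∈ lfp (Rules C)) ∧
      (Def C n = ∅ → ConditionDependsOn C n x) := by
  change Relation.ReflTransGen _ m n at h
  induction h with
  | refl =>
    exact ⟨fun y hy => mem_lfp_of_rule_two .sourceWrite (writes_mem_lfp hy) (writes_mem_lfp hx),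
      fun he => absurd hx (he ▸ Set.notMem_empty x)⟩
  | @tail k n _ hkn ih =>
    rcases hkn with ⟨v, hvk, hvn, l, hchain, hl⟩ | hcd
    -- The fact is carried only to a predecessor `p` of `n`, since `n` may itself overwrite `v`.
    -- This is the form that `stateRead` consumes; for a stack variable the position is forgotten.
    · obtain ⟨p, hpn, hp⟩ := exists_pred_mayDependOnAt l k hchain hl (ih.1 v hvk)
      have hv : Fact.varMayDepOn v x ∈ lfp (Rules C) := mem_lfp_of_rule_one .varMayDepOn hp
      refine ⟨fun y hy => ?_, fun _ => .inl ⟨v, hvn, hv⟩⟩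
      by_cases hs : v.IsStack
      · exact mem_lfp_of_rule_two (.stackRead hs) (localDep_mem_lfp hy hvn) hv
      · exact mem_lfp_of_rule_two (.stateRead hpn hs) (localDep_mem_lfp hy hvn) hp
    -- The source `k` writes nothing, so the second half of the induction hypothesis is the one that
    -- applies.
    · obtain ⟨b, z, hc, hz⟩ := hcd.exists_mayControls (ih.2 hcd.def_eq_empty)
      exact ⟨fun y hy => mem_lfp_of_rule_three .control (writes_mem_lfp hy) hc hz,
        fun _ => .inr ⟨b, z, hc, hz⟩⟩

end EVM

theorem mainTheorem4 (C : EVM.Contract) (x y : EVM.Var) :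
    ((∃ nx ny : EVM.Node, x ∈ EVM.Def C nx ∧ y ∈ EVM.Def C ny ∧ nx ∈ EVM.BS C ny) →
      EVM.Fact.varMayDepOn y x ∈ EVM.lfp (EVM.Rules C)) ∧
    (∀ n : EVM.Node,
      (∃ nif nx : EVM.Node, EVM.ControlDep C nif n ∧ x ∈ EVM.Def C nx ∧ nx ∈ EVM.BS C nif) →
      EVM.Fact.instMayDepOn n x ∈ EVM.lfp (EVM.Rules C)) := by
  constructor
  · rintro ⟨nx, ny, hx, hy, hs⟩
    exact EVM.mem_lfp_of_rule_one .varMayDepOn ((EVM.mayDependOnAt_of_mem_BS hx hs).1 y hy)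
  · rintro n ⟨nif, nx, hcd, hx, hs⟩
    obtain ⟨b, z, hc, hz⟩ :=
      hcd.exists_mayControls ((EVM.mayDependOnAt_of_mem_BS hx hs).2 hcd.def_eq_empty)
    exact EVM.mem_lfp_of_rule_two .instMayDepOn hc hz
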